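/- Let $n\ge 3$, $m\ge 1$, $r\in\mathbb N$, and let $\mathbb R^n$ carry the pseudo-Euclidean metric $g_{ij}=\varepsilon_i\delta_{ij}$ with $\varepsilon_i\in\{1,-1\}$. Let $(F^m,g_F)$ be a nonempty $m$-dimensional semi-Riemannian Einstein manifold, $\mathrm{Ric}_{g_F}=\lambda_F\,g_F$ with $\lambda_F\in\mathbb R$. Let $\alpha=(\alpha_1,\dots,\alpha_n)\in\mathbb R^n$, $\xi=\sum_{i}\alpha_i x_i$, and let $f,\varphi,h:\mathbb R\to\mathbb R$ be smooth functions of $\xi$, with $f>0$ everywhere and $\varphi,h$ nowhere zero. On $M=\mathbb R^n\times F$ consider the warped product metric $\widetilde g=\frac{1}{\varphi(\xi)^2}\,g\oplus f(\xi)^2 g_F$, and regard $h=h(\xi)$ as a function on $M$. For $\rho\in\mathbb R$, call $(M,\widetilde g,h)$ quasi-Einstein (with constant $\rho$) if $$\mathrm{Ric}_{\widetilde g}-\frac{r}{h}\,\mathrm{Hess}_{\widetilde g}h=\rho\,\widetilde g .$$ (i) If $\sum_{i}\varepsilon_i\alpha_i^2=\pm 1$, then $(M,\widetilde g,h)$ is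 quasi-Einstein with constant $\rho$ if and only if the following three equations hold for all values of $\xi\in\mathbb R$: $$(n-2)fh\varphi''-rf\varphi h''-mh\varphi f''-2mh\varphi'f'-2rf\varphi'h'=0,$$ $$\sum_{k=1}^n\varepsilon_k\alpha_k^2\bigl[fh\varphi\varphi''-(n-1)fh(\varphi')^2+mh\varphi\varphi'f'+rf\varphi\varphi'h'\bigr]=\rho fh,$$ $$\sum_{k=1}^n\varepsilon_k\alpha_k^2\bigl[-fh\varphi^2f''+(n-2)fh\varphi\varphi'f'-(m-1)h\varphi^2(f')^2-rf\varphi^2f'h'\bigr]=h\,[\rho f^2-\lambda_F].$$ (ii) If $\alpha$ is a null vector, i.e. $\alpha\ne 0$ and $\sum_{i}\varepsilon_i\alpha_i^2=0$, then $(M,\widetilde g,h)$ is quasi-Einstein with constant $\rho$ if and only if $\rho=\lambda_F=0$ and, for all $\xi\in\mathbb R$, $$(n-2)fh\varphi''-rf\varphi h''-mh\varphi f''-2mh\varphi'f'-2rf\varphi'h'=0 .$$ -/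

import Mathlib

set_option maxSynthPendingDepth 3

open scoped Manifold ContDiff Topology

section LocalGeometry

variable {E : Type*} [NormedAddCommGroup E] [NormedSpace ℝ E]

/-- The Christoffel symbols of the first kind of a metric `G` on an open part of `E`:
`christoffelFirst G u v w z = ½ (∂ᵥ G(w, z) + ∂_w G(v, z) - ∂_z G(v, w))` at the point `u`. -/
noncomputable def christoffelFirst (G : E → E →L[ℝ] E →L[ℝ] ℝ) (u : E) :
    E →L[ℝ] E →L[ℝ] E →L[ℝ] ℝ :=
  (2⁻¹ : ℝ) • (fderiv ℝ G u + (fderiv ℝ G u).flip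
    - ((ContinuousLinearMap.flipₗᵢ ℝ E E ℝ).toContinuousLinearEquiv :
        (E →L[ℝ] E →L[ℝ] ℝ) →L[ℝ] (E →L[ℝ] E →L[ℝ] ℝ)).comp (fderiv ℝ G u).flip)

theorem christoffelFirst_apply (G : E → E →L[ℝ] E →L[ℝ] ℝ) (u v w z : E) :
    christoffelFirst G u v w z
      = 2⁻¹ * (fderiv ℝ G u v w z + fderiv ℝ G u w v z - fderiv ℝ G u z v w) := rfl

/-- The Christoffel symbols of the second kind, the index being raised with the inverse of
`G u : E → E*`; this is the Levi-Civita connection `Γ(v, w)` in coordinates. -/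
noncomputable def christoffel (G : E → E →L[ℝ] E →L[ℝ] ℝ) (u : E) : E →L[ℝ] E →L[ℝ] E :=
  (ContinuousLinearMap.compL ℝ E (E →L[ℝ] ℝ) E (G u).inverse).comp (christoffelFirst G u)

/-- The curvature endomorphism `v ↦ R(v, w) z` in coordinates, where
`R(v, w) z = (∂ᵥ Γ)(w, z) - (∂_w Γ)(v, z) + Γ(v, Γ(w, z)) - Γ(w, Γ(v, z))`. -/
noncomputable def coordCurvature (G : E → E →L[ℝ] E →L[ℝ] ℝ) (u w z : E) : E →L[ℝ] E :=
  ((fderiv ℝ (christoffel G) u).flip w).flip z - (fderiv ℝ (christoffel G) u w).flip z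
    + (christoffel G u).flip (christoffel G u w z)
    - (christoffel G u w).comp ((christoffel G u).flip z)

/-- The Ricci tensor in coordinates, `Ric(w, z) = tr (v ↦ R(v, w) z)`. -/
noncomputable def coordRicci (G : E → E →L[ℝ] E →L[ℝ] ℝ) (u w z : E) : ℝ :=
  LinearMap.trace ℝ E (coordCurvature G u w z : E →ₗ[ℝ] E)

/-- The Hessian in coordinates, `Hess h (v, w) = D²h(v, w) - Dh(Γ(v, w))`. -/
noncomputable def coordHess (G : E → E →L[ℝ] E →L[ℝ] ℝ) (h : E → ℝ) (u v w : E) : ℝ :=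
  fderiv ℝ (fderiv ℝ h) u v w - fderiv ℝ h u (christoffel G u v w)

end LocalGeometry

section Manifolds

variable {E : Type*} [NormedAddCommGroup E] [NormedSpace ℝ E]
  {H : Type*} [TopologicalSpace H] {I : ModelWithCorners ℝ E H}
  {M : Type*} [TopologicalSpace M] [ChartedSpace H M]

/-- The components, in the preferred chart at `p`, of a field `g` of bilinear forms on the tangent
spaces of a manifold without boundary: the pull-back of `g` by the inverse of that chart. -/
noncomputable def chartMetric
    (g : (q : M) → TangentSpace I q →L[ℝ] TangentSpace I q →L[ℝ] ℝ) (p : M) (u : E) :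
    E →L[ℝ] E →L[ℝ] ℝ :=
  let B : E →L[ℝ] E →L[ℝ] ℝ := g ((extChartAt I p).symm u)
  let A : E →L[ℝ] E := mfderiv 𝓘(ℝ, E) I (extChartAt I p).symm u
  B.bilinearComp A A

variable (I M) in
/-- A semi-Riemannian (pseudo-Riemannian) metric of class `C^∞` on a manifold without boundary:
a symmetric nondegenerate bilinear form on every tangent space, with smooth components in the
charts. (The index is then locally constant.) -/
structure SemiRiemannianMetric where
  /-- The bilinear form on each tangent space. -/
  form : (p : M) → TangentSpace I p →L[ℝ] TangentSpace I p →L[ℝ] ℝ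
  symm : ∀ (p : M) (v w : TangentSpace I p), form p v w = form p w v
  nondegenerate : ∀ (p : M) (v : TangentSpace I p), (∀ w : TangentSpace I p, form p v w = 0) → v = 0
  smooth : ∀ p : M, ContDiffOn ℝ ∞ (chartMetric form p) (extChartAt I p).target

namespace SemiRiemannianMetric

/-- The Ricci tensor at `p`, computed in the preferred chart at `p`. The identification of
`TangentSpace I p` with the model space `E` is by definition the one given by that chart. -/
noncomputable def ricci (g : SemiRiemannianMetric I M) (p : M) (v w : TangentSpace I p) : ℝ :=
  coordRicci (chartMetric g.form p) (extChartAt I p p) v w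

/-- The Hessian (second covariant derivative) of `h` at `p`, computed in the preferred chart
at `p`. -/
noncomputable def hess (g : SemiRiemannianMetric I M) (h : M → ℝ) (p : M)
    (v w : TangentSpace I p) : ℝ :=
  coordHess (chartMetric g.form p) (h ∘ (extChartAt I p).symm) (extChartAt I p p) v w

/-- `g` is an Einstein metric with constant Ricci curvature `c`: `Ric = c g`. -/
def IsEinstein (g : SemiRiemannianMetric I M) (c : ℝ) : Prop :=
  ∀ (p : M) (v w : TangentSpace I p), g.ricci p v w = c * g.form p v w

/-- `(M, g, h)` is quasi-Einstein: `Ric - (r / h) Hess h = ρ g`. -/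
def IsQuasiEinstein (g : SemiRiemannianMetric I M) (h : M → ℝ) (r ρ : ℝ) : Prop :=
  ∀ (p : M) (v w : TangentSpace I p),
    g.ricci p v w - r / h p * g.hess h p v w = ρ * g.form p v w

end SemiRiemannianMetric

theorem contDiffOn_comp_extChartAt_symm [IsManifold I ∞ M] [I.Boundaryless] {f : M → ℝ}
    (hf : ContMDiff I 𝓘(ℝ, ℝ) ∞ f) (p : M) :
    ContDiffOn ℝ ∞ (fun u => f ((extChartAt I p).symm u)) (extChartAt I p).target := by
  rw [← contMDiffOn_iff_contDiffOn]
  exact hf.comp_contMDiffOn (contMDiffOn_extChartAt_symm p)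

/-- The conformal metric `φ⁻² g`. -/
noncomputable def SemiRiemannianMetric.conformal [IsManifold I ∞ M] [I.Boundaryless]
    (g : SemiRiemannianMetric I M) (φ : M → ℝ)
    (hφ : ContMDiff I 𝓘(ℝ, ℝ) ∞ φ) (hφ0 : ∀ p, φ p ≠ 0) : SemiRiemannianMetric I M where
  form p := (1 / φ p ^ 2) • g.form p
  symm p v w := by
    change (1 / φ p ^ 2) * g.form p v w = (1 / φ p ^ 2) * g.form p w v
    rw [g.symm]
  nondegenerate p v hv := by
    refine g.nondegenerate p v fun w => ?_
    have h1 : (1 / φ p ^ 2) * g.form p v w = 0 := hv w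
    have h2 := hφ0 p
    simpa [h2] using h1
  smooth p := by
    have h1 := contDiffOn_comp_extChartAt_symm hφ p
    have h2 : ContDiffOn ℝ ∞ (fun u => 1 / φ ((extChartAt I p).symm u) ^ 2)
        (extChartAt I p).target :=
      contDiffOn_const.div (h1.pow 2) fun u _ => pow_ne_zero 2 (hφ0 _)
    refine (h2.smul (g.smooth p)).congr fun u _ => ?_
    exact ContinuousLinearMap.ext fun v => ContinuousLinearMap.ext fun w => rfl

end Manifolds

section WarpedProduct

variable {E : Type*} [NormedAddCommGroup E] [NormedSpace ℝ E]
  {H : Type*} [TopologicalSpace H] {I : ModelWithCorners ℝ E H}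
  {B : Type*} [TopologicalSpace B] [ChartedSpace H B]
  {E' : Type*} [NormedAddCommGroup E'] [NormedSpace ℝ E']
  {H' : Type*} [TopologicalSpace H'] {I' : ModelWithCorners ℝ E' H'}
  {F : Type*} [TopologicalSpace F] [ChartedSpace H' F]

theorem contDiffOn_bilinearComp {V W : Type*} [NormedAddCommGroup V] [NormedSpace ℝ V]
    [NormedAddCommGroup W] [NormedSpace ℝ W] {s : Set V} {b : V → W →L[ℝ] W →L[ℝ] ℝ}
    (hb : ContDiffOn ℝ ∞ b s) (L : V →L[ℝ] W) :
    ContDiffOn ℝ ∞ (fun u => (b u).bilinearComp L L) s := by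
  have h1 : ContDiffOn ℝ ∞ (fun u => ((b u).comp L).flip) s :=
    (ContinuousLinearMap.flipₗᵢ ℝ V W ℝ).contDiff.comp_contDiffOn
      (hb.clm_comp contDiffOn_const)
  exact (ContinuousLinearMap.flipₗᵢ ℝ V V ℝ).contDiff.comp_contDiffOn
    (h1.clm_comp contDiffOn_const)

/-- The bilinear form `g_B ⊕ f² g_F` on the tangent space of `B × F` at `p`, which is the product
of the tangent spaces of the factors. -/
noncomputable def warpedForm (gB : SemiRiemannianMetric I B) (f : B → ℝ)
    (gF : SemiRiemannianMetric I' F) (p : B × F) :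
    TangentSpace (I.prod I') p →L[ℝ] TangentSpace (I.prod I') p →L[ℝ] ℝ :=
  let b : E →L[ℝ] E →L[ℝ] ℝ := gB.form p.1
  let c : E' →L[ℝ] E' →L[ℝ] ℝ := gF.form p.2
  (show (E × E') →L[ℝ] (E × E') →L[ℝ] ℝ from
    b.bilinearComp (.fst ℝ E E') (.fst ℝ E E')
      + (f p.1 ^ 2) • c.bilinearComp (.snd ℝ E E') (.snd ℝ E E'))

theorem warpedForm_apply (gB : SemiRiemannianMetric I B) (f : B → ℝ)
    (gF : SemiRiemannianMetric I' F) (p : B × F) (v w : TangentSpace (I.prod I') p) :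
    warpedForm gB f gF p v w
      = gB.form p.1 v.1 w.1 + f p.1 ^ 2 * gF.form p.2 v.2 w.2 := rfl

theorem chartMetric_warpedForm [IsManifold I ∞ B] [I.Boundaryless] [IsManifold I' ∞ F]
    [I'.Boundaryless] (gB : SemiRiemannianMetric I B) (f : B → ℝ)
    (gF : SemiRiemannianMetric I' F) (p : B × F) (u : E × E')
    (hu : u ∈ (extChartAt (I.prod I') p).target) :
    chartMetric (warpedForm gB f gF) p u
      = (chartMetric gB.form p.1 u.1).bilinearComp (.fst ℝ E E') (.fst ℝ E E')
        + (f ((extChartAt I p.1).symm u.1) ^ 2) •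
          (chartMetric gF.form p.2 u.2).bilinearComp (.snd ℝ E E') (.snd ℝ E E') := by
  have hu' : u.1 ∈ (extChartAt I p.1).target ∧ u.2 ∈ (extChartAt I' p.2).target := by
    rw [extChartAt_prod] at hu
    exact hu
  have h1 : MDifferentiableAt 𝓘(ℝ, E) I (extChartAt I p.1).symm u.1 :=
    ((contMDiffOn_extChartAt_symm (n := ∞) p.1).contMDiffAt
      ((isOpen_extChartAt_target p.1).mem_nhds hu'.1)).mdifferentiableAt (by simp)
  have h2 : MDifferentiableAt 𝓘(ℝ, E') I' (extChartAt I' p.2).symm u.2 :=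
    ((contMDiffOn_extChartAt_symm (n := ∞) p.2).contMDiffAt
      ((isOpen_extChartAt_target p.2).mem_nhds hu'.2)).mdifferentiableAt (by simp)
  have h3 := ((h1.hasMFDerivAt.comp u (ContinuousLinearMap.fst ℝ E E').hasMFDerivAt).prodMk
    (h2.hasMFDerivAt.comp u (ContinuousLinearMap.snd ℝ E E').hasMFDerivAt)).mfderiv
  have h4 : ((extChartAt (I.prod I') p).symm : E × E' → B × F)
      = fun x => (((extChartAt I p.1).symm ∘ Prod.fst) x,
        ((extChartAt I' p.2).symm ∘ Prod.snd) x) := by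
    rw [extChartAt_prod]
    rfl
  rw [← h4] at h3
  refine ContinuousLinearMap.ext fun v => ContinuousLinearMap.ext fun w => ?_
  change warpedForm gB f gF _ (mfderiv 𝓘(ℝ, E × E') (I.prod I') (extChartAt (I.prod I') p).symm u v)
    (mfderiv 𝓘(ℝ, E × E') (I.prod I') (extChartAt (I.prod I') p).symm u w) = _
  rw [h3, h4]
  rfl

/-- The warped product metric `g_B ⊕ f² g_F` on `B ×_f F`, with `f` smooth and positive. -/
noncomputable def SemiRiemannianMetric.warpedProduct [IsManifold I ∞ B] [I.Boundaryless]
    [IsManifold I' ∞ F] [I'.Boundaryless] (gB : SemiRiemannianMetric I B) (f : B → ℝ)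
    (hf : ContMDiff I 𝓘(ℝ, ℝ) ∞ f) (hf0 : ∀ p, 0 < f p) (gF : SemiRiemannianMetric I' F) :
    SemiRiemannianMetric (I.prod I') (B × F) where
  form := warpedForm gB f gF
  symm p v w := by
    exact congrArg₂ (fun a b : ℝ => a + f p.1 ^ 2 * b) (gB.symm p.1 v.1 w.1)
      (gF.symm p.2 v.2 w.2)
  nondegenerate p v hv := by
    have h1 : v.1 = 0 := gB.nondegenerate p.1 v.1 fun w => by
      have h0 : gF.form p.2 v.2 (0 : E') = 0 := (gF.form p.2 v.2).map_zero
      have h' : gB.form p.1 v.1 w + f p.1 ^ 2 * gF.form p.2 v.2 (0 : E') = 0 :=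
        hv ((w, 0) : E × E')
      rw [h0] at h'
      simpa using h'
    have h2 : v.2 = 0 := gF.nondegenerate p.2 v.2 fun w => by
      have h0 : gB.form p.1 v.1 (0 : E) = 0 := (gB.form p.1 v.1).map_zero
      have h' : gB.form p.1 v.1 (0 : E) + f p.1 ^ 2 * gF.form p.2 v.2 w = 0 :=
        hv ((0, w) : E × E')
      rw [h0] at h'
      have h3 := (hf0 p.1).ne'
      simpa [h3] using h'
    exact Prod.ext h1 h2
  smooth p := by
    have hsub : ∀ u ∈ (extChartAt (I.prod I') p).target,
        u.1 ∈ (extChartAt I p.1).target ∧ u.2 ∈ (extChartAt I' p.2).target := by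
      intro u hu
      rw [extChartAt_prod] at hu
      exact hu
    have hb : ContDiffOn ℝ ∞ (fun u : E × E' => chartMetric gB.form p.1 u.1)
        (extChartAt (I.prod I') p).target :=
      (gB.smooth p.1).comp contDiff_fst.contDiffOn fun u hu => (hsub u hu).1
    have hc : ContDiffOn ℝ ∞ (fun u : E × E' => chartMetric gF.form p.2 u.2)
        (extChartAt (I.prod I') p).target :=
      (gF.smooth p.2).comp contDiff_snd.contDiffOn fun u hu => (hsub u hu).2
    have hff : ContDiffOn ℝ ∞ (fun u : E × E' => f ((extChartAt I p.1).symm u.1))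
        (extChartAt (I.prod I') p).target :=
      (contDiffOn_comp_extChartAt_symm hf p.1).comp contDiff_fst.contDiffOn
        fun u hu => (hsub u hu).1
    refine ContDiffOn.congr ?_ fun u hu => chartMetric_warpedForm gB f gF p u hu
    exact (contDiffOn_bilinearComp hb _).add ((hff.pow 2).smul (contDiffOn_bilinearComp hc _))

end WarpedProduct

section PseudoEuclidean

/-- The bilinear form `∑ ε_i v_i w_i` on `ℝⁿ`. -/
noncomputable def diagonalForm {n : ℕ} (ε : Fin n → ℝ) :
    EuclideanSpace ℝ (Fin n) →L[ℝ] EuclideanSpace ℝ (Fin n) →L[ℝ] ℝ :=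
  ∑ i, ε i • (EuclideanSpace.proj i : EuclideanSpace ℝ (Fin n) →L[ℝ] ℝ).smulRight
    (EuclideanSpace.proj i : EuclideanSpace ℝ (Fin n) →L[ℝ] ℝ)

theorem diagonalForm_apply {n : ℕ} (ε : Fin n → ℝ) (v w : EuclideanSpace ℝ (Fin n)) :
    diagonalForm ε v w = ∑ i, ε i * (v i * w i) := by
  simp [diagonalForm]

/-- The pseudo-Euclidean metric `g_ij = ε_i δ_ij` on `ℝⁿ`, where each `ε_i` is `1` or `-1`. -/
noncomputable def pseudoEuclideanMetric {n : ℕ} (ε : Fin n → ℝ) (hε : ∀ i, ε i = 1 ∨ ε i = -1) :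
    SemiRiemannianMetric 𝓘(ℝ, EuclideanSpace ℝ (Fin n)) (EuclideanSpace ℝ (Fin n)) where
  form _ := diagonalForm ε
  symm p v w := by
    have key : ∀ a b : EuclideanSpace ℝ (Fin n), diagonalForm ε a b = diagonalForm ε b a := by
      intro a b
      rw [diagonalForm_apply, diagonalForm_apply]
      exact Finset.sum_congr rfl fun i _ => by rw [mul_comm (a i)]
    exact key v w
  nondegenerate p v hv := by
    have key : ∀ a : EuclideanSpace ℝ (Fin n), (∀ b, diagonalForm ε a b = 0) → a = 0 := by
      intro a ha
      refine PiLp.ext fun i => ?_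
      have h := ha (EuclideanSpace.single i (1 : ℝ))
      rw [diagonalForm_apply] at h
      have h0 : ε i ≠ 0 := by rcases hε i with h | h <;> simp [h]
      simpa [h0] using h
    exact key v hv
  smooth p := by
    refine (contDiffOn_const (c := diagonalForm ε)).congr fun u _ => ?_
    refine ContinuousLinearMap.ext fun v => ContinuousLinearMap.ext fun w => ?_
    have h1 : mfderiv 𝓘(ℝ, EuclideanSpace ℝ (Fin n)) 𝓘(ℝ, EuclideanSpace ℝ (Fin n))
        (extChartAt 𝓘(ℝ, EuclideanSpace ℝ (Fin n)) p).symm u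
          = ContinuousLinearMap.id ℝ (EuclideanSpace ℝ (Fin n)) := by
      rw [extChartAt_model_space_eq_id]
      exact mfderiv_id
    change diagonalForm ε (mfderiv 𝓘(ℝ, EuclideanSpace ℝ (Fin n)) 𝓘(ℝ, EuclideanSpace ℝ (Fin n))
        (extChartAt 𝓘(ℝ, EuclideanSpace ℝ (Fin n)) p).symm u v)
      (mfderiv 𝓘(ℝ, EuclideanSpace ℝ (Fin n)) 𝓘(ℝ, EuclideanSpace ℝ (Fin n))
        (extChartAt 𝓘(ℝ, EuclideanSpace ℝ (Fin n)) p).symm u w) = diagonalForm ε v w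
    rw [h1]
    rfl

/-- The linear function `ξ = ∑ α_i x_i` on `ℝⁿ`. -/
noncomputable def linearInvariant {n : ℕ} (α : Fin n → ℝ) (x : EuclideanSpace ℝ (Fin n)) : ℝ :=
  ∑ i, α i * x i

theorem contMDiff_comp_linearInvariant {n : ℕ} (α : Fin n → ℝ) {f : ℝ → ℝ}
    (hf : ContDiff ℝ ∞ f) :
    ContMDiff 𝓘(ℝ, EuclideanSpace ℝ (Fin n)) 𝓘(ℝ, ℝ) ∞ (fun x => f (linearInvariant α x)) := by
  refine (hf.comp ?_).contMDiff
  unfold linearInvariant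
  fun_prop

/-- The metric `φ(ξ)⁻² g ⊕ f(ξ)² g_F` on `ℝⁿ × F`, i.e. the warped product
`(ℝⁿ, φ⁻² g) ×_f F` with `g` pseudo-Euclidean and `f`, `φ` depending only on `ξ = ∑ α_i x_i`. -/
noncomputable def invariantWarpedMetric {n : ℕ} {E' : Type*} [NormedAddCommGroup E']
    [NormedSpace ℝ E'] {H' : Type*} [TopologicalSpace H'] {I' : ModelWithCorners ℝ E' H'}
    [I'.Boundaryless] {F : Type*} [TopologicalSpace F] [ChartedSpace H' F] [IsManifold I' ∞ F]
    (ε : Fin n → ℝ) (hε : ∀ i, ε i = 1 ∨ ε i = -1) (α : Fin n → ℝ) (f φ : ℝ → ℝ)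
    (hf : ContDiff ℝ ∞ f) (hf0 : ∀ t, 0 < f t) (hφ : ContDiff ℝ ∞ φ) (hφ0 : ∀ t, φ t ≠ 0)
    (gF : SemiRiemannianMetric I' F) :
    SemiRiemannianMetric (𝓘(ℝ, EuclideanSpace ℝ (Fin n)).prod I')
      (EuclideanSpace ℝ (Fin n) × F) :=
  SemiRiemannianMetric.warpedProduct
    ((pseudoEuclideanMetric ε hε).conformal (fun x => φ (linearInvariant α x))
      (contMDiff_comp_linearInvariant α hφ) (fun _ => hφ0 _))
    (fun x => f (linearInvariant α x)) (contMDiff_comp_linearInvariant α hf) (fun _ => hf0 _) gF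

end PseudoEuclidean

/-! ### Levi-Civita connection of a metric in coordinates -/

section CoordinateMetrics

variable {E : Type*} [NormedAddCommGroup E] [NormedSpace ℝ E]

/-! In the product of the identity chart of ℝⁿ and a chart of F, the metric is φ(a)⁻² D ⊕ f(a)² K,
with D the constant diagonal form, a the linear form ξ and K the fibre metric in the chart. Let N be
the vector D-dual to a, so that a(N) = Σ ε_k α_k². The Koszul formula gives the Christoffel symbols
explicitly (`christoffel_coordWarped`). They depend on ξ only through P = φ'/φ, Q = f f' φ² and R =
f'/f.

The Ricci tensor is a trace over V × W, the sum of the traces of two diagonal blocks of the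
curvature endomorphism. Each block is a multiple of the identity plus rank-one maps, plus the
curvature of K on the fibre, so its trace can be read off. As Ric_K = λ_F K, the tensor Ric − (r/h)
Hess h − ρ g̃ becomes A a⊗a + B D + C K with no mixed terms (`coord_quasiEinstein_defect`). Up to
nonvanishing factors, A, B and C are the defects of the three differential equations.

The tensors a⊗a and D are linearly independent since n ≥ 2 and α ≠ 0
(`eq_zero_of_rank_one_add_diagonal`), K is nonzero since m ≥ 1, and ξ takes every real value. The
quasi-Einstein condition is therefore A = B = C = 0 for all ξ, whatever the causal type of α. The
sum ±1 forces α ≠ 0; in the null case a(N) = 0 reduces the last two equations to ρ = λ_F = 0. -/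

theorem ContinuousLinearMap.isInvertible_of_nondegenerate [FiniteDimensional ℝ E]
    {b : E →L[ℝ] E →L[ℝ] ℝ} (hb : ∀ v, (∀ w, b v w = 0) → v = 0) : b.IsInvertible := by
  have hinj : Function.Injective (b : E →ₗ[ℝ] E →L[ℝ] ℝ) := by
    rw [injective_iff_map_eq_zero]
    intro v hv
    exact hb v fun w => congrArg (fun l : E →L[ℝ] ℝ => l w) hv
  have hrank : Module.finrank ℝ E = Module.finrank ℝ (E →L[ℝ] ℝ) := by
    rw [← (LinearMap.toContinuousLinearMap : (E →ₗ[ℝ] ℝ) ≃ₗ[ℝ] (E →L[ℝ] ℝ)).finrank_eq]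
    exact (Subspace.dual_finrank_eq (K := ℝ) (V := E)).symm
  exact ⟨(LinearMap.linearEquivOfInjective _ hinj hrank).toContinuousLinearEquiv,
    ContinuousLinearMap.ext fun v => rfl⟩

/-- A smooth field of nondegenerate symmetric bilinear forms on an open subset of `E`. -/
structure IsCoordMetricOn (G : E → E →L[ℝ] E →L[ℝ] ℝ) (S : Set E) : Prop where
  isOpen : IsOpen S
  smooth : ContDiffOn ℝ ∞ G S
  symm : ∀ u ∈ S, ∀ v w, G u v w = G u w v
  nondegenerate : ∀ u ∈ S, ∀ v, (∀ w, G u v w = 0) → v = 0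

theorem christoffel_apply (G : E → E →L[ℝ] E →L[ℝ] ℝ) (u v w : E) :
    christoffel G u v w = (G u).inverse (christoffelFirst G u v w) := rfl

theorem hasFDerivAt_apply_apply {X V W Y : Type*} [NormedAddCommGroup X] [NormedSpace ℝ X]
    [NormedAddCommGroup V] [NormedSpace ℝ V] [NormedAddCommGroup W] [NormedSpace ℝ W]
    [NormedAddCommGroup Y] [NormedSpace ℝ Y] {G : X → V →L[ℝ] W →L[ℝ] Y} {u : X}
    (hG : DifferentiableAt ℝ G u) (w : V) (z : W) :
    HasFDerivAt (fun x => G x w z) (((fderiv ℝ G u).flip w).flip z) u := by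
  have h1 := (hG.hasFDerivAt.clm_apply (hasFDerivAt_const w u)).clm_apply (hasFDerivAt_const z u)
  simpa using h1

namespace IsCoordMetricOn

variable {G : E → E →L[ℝ] E →L[ℝ] ℝ} {S : Set E} {u : E}

theorem contDiffAt (hG : IsCoordMetricOn G S) (hu : u ∈ S) : ContDiffAt ℝ ∞ G u :=
  hG.smooth.contDiffAt (hG.isOpen.mem_nhds hu)

theorem differentiableAt (hG : IsCoordMetricOn G S) (hu : u ∈ S) : DifferentiableAt ℝ G u :=
  (hG.contDiffAt hu).differentiableAt (by simp)

theorem fderiv_symm (hG : IsCoordMetricOn G S) (hu : u ∈ S) (v w z : E) :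
    fderiv ℝ G u v w z = fderiv ℝ G u v z w := by
  have h1 := hasFDerivAt_apply_apply (hG.differentiableAt hu) w z
  have h2 := hasFDerivAt_apply_apply (hG.differentiableAt hu) z w
  have h3 : (fun x => G x w z) =ᶠ[𝓝 u] fun x => G x z w := by
    filter_upwards [hG.isOpen.mem_nhds hu] with x hx using hG.symm x hx w z
  exact congrArg (fun l : E →L[ℝ] ℝ => l v) (h1.unique (h2.congr_of_eventuallyEq h3))

variable [FiniteDimensional ℝ E]

theorem isInvertible (hG : IsCoordMetricOn G S) (hu : u ∈ S) : (G u).IsInvertible :=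
  ContinuousLinearMap.isInvertible_of_nondegenerate (hG.nondegenerate u hu)

theorem apply_christoffel (hG : IsCoordMetricOn G S) (hu : u ∈ S) (v w z : E) :
    G u (christoffel G u v w) z = christoffelFirst G u v w z := by
  rw [christoffel_apply, (hG.isInvertible hu).self_apply_inverse]

/-- Nondegeneracy makes the Koszul identity determine the connection, so a guessed formula need only
be tested against every z. This avoids computing the inverse metric. -/
theorem christoffel_eq (hG : IsCoordMetricOn G S) (hu : u ∈ S) {v w x : E}
    (hx : ∀ z, G u x z = christoffelFirst G u v w z) : christoffel G u v w = x := by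
  rw [christoffel_apply, ← ContinuousLinearMap.ext hx, (hG.isInvertible hu).inverse_apply_self]

theorem christoffel_symm (hG : IsCoordMetricOn G S) (hu : u ∈ S) (v w : E) :
    christoffel G u v w = christoffel G u w v := by
  refine hG.christoffel_eq hu fun z => ?_
  rw [hG.apply_christoffel hu, christoffelFirst_apply, christoffelFirst_apply,
    hG.fderiv_symm hu z v w]
  ring

/-- Inversion of operators is smooth at an invertible one, and the first-kind symbols are linear in
the derivative of the smooth G. The curvature, which differentiates the connection, is thus
meaningful. -/
theorem differentiableAt_christoffel (hG : IsCoordMetricOn G S) (hu : u ∈ S) :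
    DifferentiableAt ℝ (christoffel G) u := by
  have h1 : DifferentiableAt ℝ (fderiv ℝ G) u :=
    ((hG.contDiffAt hu).fderiv_right (m := 1) (by norm_cast)).differentiableAt (by simp)
  have h2 : DifferentiableAt ℝ (fun x => (G x).inverse) u :=
    (((hG.isInvertible hu).contDiffAt_map_inverse (n := 1)).differentiableAt (by simp)).comp u
      (hG.differentiableAt hu)
  have h3 : DifferentiableAt ℝ (fun x => (fderiv ℝ G x).flip) u :=
    (ContinuousLinearMap.flipₗᵢ ℝ E E (E →L[ℝ] ℝ)).toContinuousLinearEquiv.differentiableAt.comp u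
      h1
  have h4 : DifferentiableAt ℝ (christoffelFirst G) u := by
    unfold christoffelFirst
    exact ((h1.add h3).sub ((differentiableAt_const _).clm_comp h3)).const_smul (2⁻¹ : ℝ)
  have h5 : DifferentiableAt ℝ
      (fun x => ContinuousLinearMap.compL ℝ E (E →L[ℝ] ℝ) E (G x).inverse) u :=
    (ContinuousLinearMap.compL ℝ E (E →L[ℝ] ℝ) E).differentiableAt.comp u h2
  exact h5.clm_comp h4

theorem hasFDerivAt_christoffel (hG : IsCoordMetricOn G S) (hu : u ∈ S) (w z : E) :
    HasFDerivAt (fun x => christoffel G x w z) (((fderiv ℝ (christoffel G) u).flip w).flip z) u :=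
  hasFDerivAt_apply_apply (hG.differentiableAt_christoffel hu) w z

end IsCoordMetricOn

theorem christoffel_congr {G G' : E → E →L[ℝ] E →L[ℝ] ℝ} {u : E} (h : G =ᶠ[𝓝 u] G') :
    christoffel G u = christoffel G' u := by
  simp only [christoffel, christoffelFirst, h.fderiv_eq, h.eq_of_nhds]

/-- Curvature depends only on the germ of the metric. This matters because the chart expression of
the warped metric is known only near the base point. -/
theorem coordRicci_congr {G G' : E → E →L[ℝ] E →L[ℝ] ℝ} {u : E} (h : G =ᶠ[𝓝 u] G') (v w : E) :
    coordRicci G u v w = coordRicci G' u v w := by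
  have h1 : christoffel G =ᶠ[𝓝 u] christoffel G' :=
    h.eventuallyEq_nhds.mono fun _ hx => christoffel_congr hx
  simp only [coordRicci, coordCurvature, h1.fderiv_eq, h1.eq_of_nhds]

theorem coordHess_congr {G G' : E → E →L[ℝ] E →L[ℝ] ℝ} {u : E} (h : G =ᶠ[𝓝 u] G')
    {k k' : E → ℝ} (hk : k =ᶠ[𝓝 u] k') (v w : E) :
    coordHess G k u v w = coordHess G' k' u v w := by
  simp only [coordHess, hk.fderiv.fderiv_eq, hk.fderiv_eq, christoffel_congr h]

end CoordinateMetrics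

/-! ### Christoffel symbols of the warped metric in coordinates -/

section CoordinateWarpedProduct

variable {V W : Type*} [NormedAddCommGroup V] [NormedSpace ℝ V]
  [NormedAddCommGroup W] [NormedSpace ℝ W]

/-- The metric `φ(a)⁻² D ⊕ f(a)² K` on an open part of `V × W`, where `D` is a constant bilinear
form and `a` a linear form on `V`. -/
noncomputable def coordWarped (D : V →L[ℝ] V →L[ℝ] ℝ) (a : V →L[ℝ] ℝ) (φ f : ℝ → ℝ)
    (K : W → W →L[ℝ] W →L[ℝ] ℝ) (u : V × W) : V × W →L[ℝ] V × W →L[ℝ] ℝ :=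
  (1 / φ (a u.1) ^ 2) • D.bilinearComp (.fst ℝ V W) (.fst ℝ V W)
    + (f (a u.1) ^ 2) • (K u.2).bilinearComp (.snd ℝ V W) (.snd ℝ V W)

variable {D : V →L[ℝ] V →L[ℝ] ℝ} {a : V →L[ℝ] ℝ} {φ f : ℝ → ℝ} {K : W → W →L[ℝ] W →L[ℝ] ℝ}
  {S : Set W} {N : V}

theorem coordWarped_apply (D : V →L[ℝ] V →L[ℝ] ℝ) (a : V →L[ℝ] ℝ) (φ f : ℝ → ℝ)
    (K : W → W →L[ℝ] W →L[ℝ] ℝ) (u v w : V × W) :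
    coordWarped D a φ f K u v w
      = 1 / φ (a u.1) ^ 2 * D v.1 w.1 + f (a u.1) ^ 2 * K u.2 v.2 w.2 := rfl

theorem hasFDerivAt_comp_fst {k : ℝ → ℝ} (a : V →L[ℝ] ℝ) {u : V × W}
    (hk : DifferentiableAt ℝ k (a u.1)) :
    HasFDerivAt (fun x : V × W => k (a x.1)) (deriv k (a u.1) • a.comp (.fst ℝ V W)) u :=
  hk.hasDerivAt.comp_hasFDerivAt (f := fun x : V × W => a x.1) u
    (a.comp (.fst ℝ V W)).hasFDerivAt

theorem isCoordMetricOn_coordWarped (hD : ∀ v w, D v w = D w v)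
    (hD0 : ∀ v, (∀ w, D v w = 0) → v = 0) (hφ : ContDiff ℝ ∞ φ) (hφ0 : ∀ t, φ t ≠ 0)
    (hf : ContDiff ℝ ∞ f) (hf0 : ∀ t, f t ≠ 0) (hK : IsCoordMetricOn K S) :
    IsCoordMetricOn (coordWarped D a φ f K) (Prod.snd ⁻¹' S) where
  isOpen := hK.isOpen.preimage continuous_snd
  smooth := by
    have ha : ContDiff ℝ ∞ fun u : V × W => a u.1 := a.contDiff.comp contDiff_fst
    have h1 : ContDiff ℝ ∞ fun u : V × W => 1 / φ (a u.1) ^ 2 :=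
      contDiff_const.div ((hφ.comp ha).pow 2) fun u => pow_ne_zero 2 (hφ0 _)
    have h2 : ContDiffOn ℝ ∞ (fun u : V × W => K u.2) (Prod.snd ⁻¹' S) :=
      hK.smooth.comp contDiff_snd.contDiffOn fun u hu => hu
    exact (h1.smul contDiff_const).contDiffOn.add
      (((hf.comp ha).pow 2).contDiffOn.smul (contDiffOn_bilinearComp h2 _))
  symm u hu v w := by
    simp only [coordWarped_apply, hD v.1 w.1, hK.symm u.2 hu v.2 w.2]
  nondegenerate u hu v hv := by
    refine Prod.ext (hD0 _ fun w => ?_) (hK.nondegenerate u.2 hu _ fun w => ?_)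
    · simpa [coordWarped_apply, hφ0] using hv (w, 0)
    · simpa [coordWarped_apply, hf0] using hv (0, w)

theorem fderiv_coordWarped (hφ : Differentiable ℝ φ) (hφ0 : ∀ t, φ t ≠ 0)
    (hf : Differentiable ℝ f) {u : V × W} (hK : DifferentiableAt ℝ K u.2)
    (hG : DifferentiableAt ℝ (coordWarped D a φ f K) u) (v w z : V × W) :
    fderiv ℝ (coordWarped D a φ f K) u v w z
      = -(2 * deriv φ (a u.1) / φ (a u.1) ^ 3 * a v.1 * D w.1 z.1)
        + 2 * f (a u.1) * deriv f (a u.1) * a v.1 * K u.2 w.2 z.2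
        + f (a u.1) ^ 2 * fderiv ℝ K u.2 v.2 w.2 z.2 := by
  have h0 := hasFDerivAt_apply_apply hG w z
  -- The conformal factor is differentiated as (φ²)⁻¹, the source of −2φ'/φ³.
  have h1 := (((hφ (a u.1)).hasDerivAt.pow 2).inv (pow_ne_zero 2 (hφ0 _))).comp_hasFDerivAt
    (f := fun x : V × W => a x.1) u (a.comp (.fst ℝ V W)).hasFDerivAt
  have h2 := hasFDerivAt_comp_fst a (hf (a u.1)) (u := u)
  have h3 : HasFDerivAt (fun x : V × W => K x.2 w.2 z.2) _ u :=
    (hasFDerivAt_apply_apply hK w.2 z.2).comp u (ContinuousLinearMap.snd ℝ V W).hasFDerivAt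
  have h4 := (h1.mul_const (D w.1 z.1)).add ((h2.pow 2).mul h3)
  have h5 := h0.unique (h4.congr_of_eventuallyEq (.of_forall fun x => ?_))
  · have h6 := congrArg (fun l : V × W →L[ℝ] ℝ => l v) h5
    simp at h6
    rw [h6]
    have := hφ0 (a u.1)
    field_simp
    ring
  · simp [coordWarped_apply]

variable [FiniteDimensional ℝ V] [FiniteDimensional ℝ W]

/-- The φ'/φ term is the usual conformal correction to a flat connection. The fibre contributes −f
f' K times the gradient of ξ, which for φ⁻² D is φ² N, and mixed directions scale by f'/f. The
formula is confirmed through the Koszul identity. -/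
theorem christoffel_coordWarped (hD : ∀ v w, D v w = D w v)
    (hD0 : ∀ v, (∀ w, D v w = 0) → v = 0) (hφ : ContDiff ℝ ∞ φ) (hφ0 : ∀ t, φ t ≠ 0)
    (hf : ContDiff ℝ ∞ f) (hf0 : ∀ t, f t ≠ 0) (hK : IsCoordMetricOn K S)
    (hN : ∀ z, D N z = a z) {u : V × W} (hu : u.2 ∈ S) (v w : V × W) :
    christoffel (coordWarped D a φ f K) u v w
      = (-(deriv φ (a u.1) / φ (a u.1)) • (a v.1 • w.1 + a w.1 • v.1 - D v.1 w.1 • N)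
          - (f (a u.1) * deriv f (a u.1) * φ (a u.1) ^ 2 * K u.2 v.2 w.2) • N,
        christoffel K u.2 v.2 w.2
          + (deriv f (a u.1) / f (a u.1)) • (a v.1 • w.2 + a w.1 • v.2)) := by
  have hG := isCoordMetricOn_coordWarped (a := a) hD hD0 hφ hφ0 hf hf0 hK
  refine hG.christoffel_eq hu fun z => ?_
  have hd := fderiv_coordWarped (hφ.differentiable (by simp)) hφ0 (hf.differentiable (by simp))
    (hK.differentiableAt hu) (hG.differentiableAt hu)
  rw [christoffelFirst_apply, hd, hd, hd, coordWarped_apply]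
  have h1 := hK.apply_christoffel hu v.2 w.2 z.2
  rw [christoffelFirst_apply] at h1
  simp [hN, h1]
  have := hφ0 (a u.1)
  have := hf0 (a u.1)
  rw [hK.symm u.2 hu w.2 z.2, hD w.1 z.1, hD v.1 z.1, hK.symm u.2 hu v.2 z.2]
  field_simp
  ring

end CoordinateWarpedProduct

/-! ### Block traces of the curvature endomorphism -/

section WarpedCurvature

/-- Write L as its restrictions to the two factors composed with the projections; cyclicity of the
trace then moves each projection to the other side. -/
theorem LinearMap.trace_prod_eq_add {R M N : Type*} [CommRing R] [AddCommGroup M] [Module R M]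
    [Module.Free R M] [Module.Finite R M] [AddCommGroup N] [Module R N] [Module.Free R N]
    [Module.Finite R N] (L : M × N →ₗ[R] M × N) :
    LinearMap.trace R (M × N) L
      = LinearMap.trace R M (.fst R M N ∘ₗ L ∘ₗ .inl R M N)
        + LinearMap.trace R N (.snd R M N ∘ₗ L ∘ₗ .inr R M N) := by
  have h : L = (L ∘ₗ .inl R M N) ∘ₗ .fst R M N + (L ∘ₗ .inr R M N) ∘ₗ .snd R M N := by
    refine LinearMap.ext fun x => ?_
    simp [← map_add]
  conv_lhs => rw [h, map_add, LinearMap.trace_comp_comm' (.fst R M N),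
    LinearMap.trace_comp_comm' (.snd R M N)]

variable {V W : Type*} [NormedAddCommGroup V] [NormedSpace ℝ V]
  [NormedAddCommGroup W] [NormedSpace ℝ W]

theorem coordCurvature_apply (G : V → V →L[ℝ] V →L[ℝ] ℝ) (u v w z : V) :
    coordCurvature G u w z v
      = fderiv ℝ (christoffel G) u v w z - fderiv ℝ (christoffel G) u w v z
        + christoffel G u v (christoffel G u w z) - christoffel G u w (christoffel G u v z) := rfl

variable [FiniteDimensional ℝ V] [FiniteDimensional ℝ W]
  {D : V →L[ℝ] V →L[ℝ] ℝ} {a : V →L[ℝ] ℝ} {K : W → W →L[ℝ] W →L[ℝ] ℝ}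
  {S : Set W} {N : V} {G : V × W → V × W →L[ℝ] V × W →L[ℝ] ℝ} {P Q R : ℝ → ℝ}

/-- The Christoffel symbols of the warped metrics considered here, with coefficient functions
`P`, `Q`, `R` of the linear invariant. -/
noncomputable def warpedChristoffel (D : V →L[ℝ] V →L[ℝ] ℝ) (a : V →L[ℝ] ℝ)
    (K : W → W →L[ℝ] W →L[ℝ] ℝ) (N : V) (P Q R : ℝ → ℝ) (u v w : V × W) : V × W :=
  (-P (a u.1) • (a v.1 • w.1 + a w.1 • v.1 - D v.1 w.1 • N) - (Q (a u.1) * K u.2 v.2 w.2) • N,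
    christoffel K u.2 v.2 w.2 + R (a u.1) • (a v.1 • w.2 + a w.1 • v.2))

theorem fderiv_christoffel_of_warped (hK : IsCoordMetricOn K S)
    (hG : IsCoordMetricOn G (Prod.snd ⁻¹' S))
    (hΓ : ∀ u v w, u.2 ∈ S → christoffel G u v w = warpedChristoffel D a K N P Q R u v w)
    {u : V × W} (hu : u.2 ∈ S) (hP : DifferentiableAt ℝ P (a u.1))
    (hQ : DifferentiableAt ℝ Q (a u.1)) (hR : DifferentiableAt ℝ R (a u.1)) (v w z : V × W) :
    fderiv ℝ (christoffel G) u v w z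
      = (-(deriv P (a u.1) * a v.1) • (a w.1 • z.1 + a z.1 • w.1 - D w.1 z.1 • N)
          - (deriv Q (a u.1) * a v.1 * K u.2 w.2 z.2
              + Q (a u.1) * fderiv ℝ K u.2 v.2 w.2 z.2) • N,
        fderiv ℝ (christoffel K) u.2 v.2 w.2 z.2
          + (deriv R (a u.1) * a v.1) • (a w.1 • z.2 + a z.1 • w.2)) := by
  have hsnd := (ContinuousLinearMap.snd ℝ V W).hasFDerivAt (x := u)
  have h1 : HasFDerivAt (fun x : V × W => K x.2 w.2 z.2) _ u :=
    (hasFDerivAt_apply_apply (hK.differentiableAt hu) w.2 z.2).comp u hsnd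
  have h2 : HasFDerivAt (fun x : V × W => christoffel K x.2 w.2 z.2) _ u :=
    (hK.hasFDerivAt_christoffel hu w.2 z.2).comp u hsnd
  have h3 := (((hasFDerivAt_comp_fst a hP).neg.smul_const
      (a w.1 • z.1 + a z.1 • w.1 - D w.1 z.1 • N)).sub
        (((hasFDerivAt_comp_fst a hQ).mul h1).smul_const N)).prodMk
    (h2.add ((hasFDerivAt_comp_fst a hR).smul_const (a w.1 • z.2 + a z.1 • w.2)))
  have h4 : (fun x => christoffel G x w z) =ᶠ[𝓝 u]
      fun x => warpedChristoffel D a K N P Q R x w z := by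
    filter_upwards [hG.isOpen.mem_nhds hu] with x hx using hΓ x w z hx
  have h5 := (hG.hasFDerivAt_christoffel hu w z).unique (h3.congr_of_eventuallyEq h4)
  have h6 := congrArg (fun l : V × W →L[ℝ] V × W => l v) h5
  simp only [ContinuousLinearMap.flip_apply] at h6
  rw [h6]
  refine Prod.ext ?_ ?_
  · simp
    module
  · simp

/-- As a function of v ∈ V, the V-part of R(v, w)z is a multiple of v plus terms ℓ(v) x with ℓ a
linear form, and such a rank-one map has trace ℓ(x). -/
theorem trace_fst_block_of_warped (hD : ∀ v w, D v w = D w v) (hK : IsCoordMetricOn K S)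
    (hG : IsCoordMetricOn G (Prod.snd ⁻¹' S)) (hN : ∀ z, D N z = a z)
    (hΓ : ∀ u v w, u.2 ∈ S → christoffel G u v w = warpedChristoffel D a K N P Q R u v w)
    {u : V × W} (hu : u.2 ∈ S) (hP : DifferentiableAt ℝ P (a u.1))
    (hQ : DifferentiableAt ℝ Q (a u.1)) (hR : DifferentiableAt ℝ R (a u.1)) (w z : V × W) :
    LinearMap.trace ℝ V (.fst ℝ V W ∘ₗ (coordCurvature G u w z : V × W →ₗ[ℝ] V × W) ∘ₗ
        .inl ℝ V W)
      = (Module.finrank ℝ V - 2) * (deriv P (a u.1) + P (a u.1) ^ 2) * (a w.1 * a z.1)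
        + (deriv P (a u.1) - (Module.finrank ℝ V - 2) * P (a u.1) ^ 2) * a N * D w.1 z.1
        + (-deriv Q (a u.1) + Module.finrank ℝ V * P (a u.1) * Q (a u.1)
            + Q (a u.1) * R (a u.1)) * a N * K u.2 w.2 z.2 := by
  set p := P (a u.1) with hp
  set q := Q (a u.1) with hq
  set r := R (a u.1) with hr
  set p' := deriv P (a u.1) with hp'
  set q' := deriv Q (a u.1) with hq'
  set k := K u.2 w.2 z.2 with hk
  -- The V-component of Γ(w, z). It enters the trace only through a(y), because D(y, N) = a(y);
  -- elsewhere it stays an atom.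
  set y := -p • (a w.1 • z.1 + a z.1 • w.1 - D w.1 z.1 • N) - (q * k) • N with hy
  have hay : a y = -p * (2 * (a w.1 * a z.1) - D w.1 z.1 * a N) - q * k * a N := by
    simp only [hy, map_sub, map_add, map_smul, smul_eq_mul]
    ring
  have h : (.fst ℝ V W ∘ₗ (coordCurvature G u w z : V × W →ₗ[ℝ] V × W) ∘ₗ .inl ℝ V W)
      = (p' * a w.1 * a z.1 - p * a y - p ^ 2 * a w.1 * a z.1) • LinearMap.id
        + (a : V →ₗ[ℝ] ℝ).smulRight (-p' • (a w.1 • z.1 + a z.1 • w.1 - D w.1 z.1 • N)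
            - (q' * k) • N + (p' * a w.1) • z.1 - p • y - (p ^ 2 * a w.1) • z.1
            - (2 * p ^ 2 * a z.1) • w.1 + (p ^ 2 * D w.1 z.1) • N + (q * r * k) • N)
        + (D z.1 : V →ₗ[ℝ] ℝ).smulRight (-(p' * a w.1) • N + (p ^ 2 * a N) • w.1)
        + (D y : V →ₗ[ℝ] ℝ).smulRight (p • N)
        + (D w.1 : V →ₗ[ℝ] ℝ).smulRight ((p ^ 2 * a z.1) • N) := by
    refine LinearMap.ext fun v => ?_
    have hN' : ∀ x, D x N = a x := fun x => by rw [hD, hN]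
    have hg : warpedChristoffel D a K N P Q R u w z
      = (y, christoffel K u.2 w.2 z.2 + r • (a w.1 • z.2 + a z.1 • w.2)) := rfl
    simp only [LinearMap.comp_apply, ContinuousLinearMap.coe_coe, coordCurvature_apply,
      fderiv_christoffel_of_warped hK hG hΓ hu hP hQ hR, hΓ u _ _ hu, LinearMap.inl_apply,
      LinearMap.fst_apply, Prod.fst_add, Prod.fst_sub]
    rw [hg]
    clear hg
    clear_value y
    simp only [warpedChristoffel, ← hp, ← hq, ← hr, ← hp', ← hq', map_zero, mul_zero, zero_smul,
      smul_zero, add_zero, map_add, map_sub, map_smul, zero_apply, smul_eq_mul,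
      LinearMap.add_apply, LinearMap.smul_apply, LinearMap.id_apply,
      LinearMap.smulRight_apply, ContinuousLinearMap.coe_coe, hN', hD v, ← hk]
    module
  rw [h]
  simp only [map_add, map_smul, LinearMap.trace_id, LinearMap.trace_smulRight,
    ContinuousLinearMap.coe_coe, map_sub, smul_eq_mul, hD _ N, hN, hD z.1 w.1, hay]
  ring

/-- On the fibre block the connection terms of K cancel, apart from those forming its own curvature.
What remains is a multiple of the identity and one rank-one map, whose trace produces the shift from
dim W to dim W − 1. -/
theorem trace_snd_block_of_warped (hK : IsCoordMetricOn K S)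
    (hG : IsCoordMetricOn G (Prod.snd ⁻¹' S))
    (hΓ : ∀ u v w, u.2 ∈ S → christoffel G u v w = warpedChristoffel D a K N P Q R u v w)
    {u : V × W} (hu : u.2 ∈ S) (hP : DifferentiableAt ℝ P (a u.1))
    (hQ : DifferentiableAt ℝ Q (a u.1)) (hR : DifferentiableAt ℝ R (a u.1)) (w z : V × W) :
    LinearMap.trace ℝ W (.snd ℝ V W ∘ₗ (coordCurvature G u w z : V × W →ₗ[ℝ] V × W) ∘ₗ
        .inr ℝ V W)
      = coordRicci K u.2 w.2 z.2
        - Module.finrank ℝ W * (deriv R (a u.1) + R (a u.1) ^ 2 + 2 * P (a u.1) * R (a u.1))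
            * (a w.1 * a z.1)
        + Module.finrank ℝ W * P (a u.1) * R (a u.1) * a N * D w.1 z.1
        - (Module.finrank ℝ W - 1) * (Q (a u.1) * R (a u.1)) * a N * K u.2 w.2 z.2 := by
  set p := P (a u.1) with hp
  set q := Q (a u.1) with hq
  set r := R (a u.1) with hr
  set r' := deriv R (a u.1) with hr'
  set k := K u.2 w.2 z.2 with hk
  set y := -p • (a w.1 • z.1 + a z.1 • w.1 - D w.1 z.1 • N) - (q * k) • N with hy
  have hay : a y = -p * (2 * (a w.1 * a z.1) - D w.1 z.1 * a N) - q * k * a N := by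
    simp only [hy, map_sub, map_add, map_smul, smul_eq_mul]
    ring
  have h : (.snd ℝ V W ∘ₗ (coordCurvature G u w z : V × W →ₗ[ℝ] V × W) ∘ₗ .inr ℝ V W)
      = (coordCurvature K u.2 w.2 z.2 : W →ₗ[ℝ] W)
        + (-(r' * a w.1 * a z.1) + r * a y - r ^ 2 * a w.1 * a z.1) • LinearMap.id
        + (K u.2 z.2 : W →ₗ[ℝ] ℝ).smulRight ((r * q * a N) • w.2) := by
    refine LinearMap.ext fun v => ?_
    have hg : warpedChristoffel D a K N P Q R u w z
      = (y, christoffel K u.2 w.2 z.2 + r • (a w.1 • z.2 + a z.1 • w.2)) := rfl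
    simp only [LinearMap.comp_apply, ContinuousLinearMap.coe_coe, coordCurvature_apply,
      fderiv_christoffel_of_warped hK hG hΓ hu hP hQ hR, hΓ u _ _ hu, LinearMap.inr_apply,
      LinearMap.snd_apply, Prod.snd_add, Prod.snd_sub]
    rw [hg]
    clear hg
    clear_value y
    simp only [warpedChristoffel, ← hp, ← hq, ← hr, ← hr', map_zero, mul_zero, zero_smul,
      smul_zero, add_zero, zero_add, sub_zero, zero_sub, neg_smul, map_neg, map_add,
      map_smul, zero_apply,
      smul_eq_mul, LinearMap.add_apply, LinearMap.smul_apply,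
      LinearMap.id_apply, coordCurvature_apply,
      LinearMap.smulRight_apply, ContinuousLinearMap.coe_coe, hK.symm u.2 hu v z.2,
      hK.christoffel_symm hu v w.2]
    module
  rw [h]
  simp only [map_add, map_smul, LinearMap.trace_id, LinearMap.trace_smulRight,
    ContinuousLinearMap.coe_coe, smul_eq_mul, hK.symm u.2 hu z.2 w.2, hay, coordRicci]
  ring

end WarpedCurvature

/-! ### Ricci tensor, Hessian and quasi-Einstein defect in coordinates -/

section WarpedQuasiEinstein

variable {V W : Type*} [NormedAddCommGroup V] [NormedSpace ℝ V]
  [NormedAddCommGroup W] [NormedSpace ℝ W] [FiniteDimensional ℝ V] [FiniteDimensional ℝ W]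
  {D : V →L[ℝ] V →L[ℝ] ℝ} {a : V →L[ℝ] ℝ} {K : W → W →L[ℝ] W →L[ℝ] ℝ}
  {S : Set W} {N : V} {φ f h : ℝ → ℝ}

theorem coordRicci_coordWarped (hD : ∀ v w, D v w = D w v)
    (hD0 : ∀ v, (∀ w, D v w = 0) → v = 0) (hφ : ContDiff ℝ ∞ φ) (hφ0 : ∀ t, φ t ≠ 0)
    (hf : ContDiff ℝ ∞ f) (hf0 : ∀ t, f t ≠ 0) (hK : IsCoordMetricOn K S)
    (hN : ∀ z, D N z = a z) {u : V × W} (hu : u.2 ∈ S) {t : ℝ} (ht : a u.1 = t) (w z : V × W) :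
    coordRicci (coordWarped D a φ f K) u w z
      = coordRicci K u.2 w.2 z.2
        + ((Module.finrank ℝ V - 2) * (deriv (deriv φ) t / φ t)
            - Module.finrank ℝ W * (deriv (deriv f) t / f t
              + 2 * deriv φ t * deriv f t / (φ t * f t))) * (a w.1 * a z.1)
        + (deriv (deriv φ) t / φ t - (Module.finrank ℝ V - 1) * (deriv φ t / φ t) ^ 2
            + Module.finrank ℝ W * (deriv φ t * deriv f t / (φ t * f t))) * a N * D w.1 z.1
        + (-(f t * φ t ^ 2 * deriv (deriv f) t)
            + (Module.finrank ℝ V - 2) * (f t * φ t * deriv φ t * deriv f t)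
            - (Module.finrank ℝ W - 1) * (φ t ^ 2 * deriv f t ^ 2)) * a N * K u.2 w.2 z.2 := by
  subst ht
  set t := a u.1 with ht
  have hφ1 : HasDerivAt φ (deriv φ t) t := (hφ.differentiable (by simp) t).hasDerivAt
  have hf1 : HasDerivAt f (deriv f t) t := (hf.differentiable (by simp) t).hasDerivAt
  have hφ2 : HasDerivAt (deriv φ) (deriv (deriv φ) t) t :=
    ((contDiff_infty_iff_deriv.1 hφ).2.differentiable (by simp) t).hasDerivAt
  have hf2 : HasDerivAt (deriv f) (deriv (deriv f) t) t :=
    ((contDiff_infty_iff_deriv.1 hf).2.differentiable (by simp) t).hasDerivAt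
  -- The quotient rule gives P' + P² = φ''/φ and R' + R² = f''/f, which collapse the block traces.
  have hP := hφ2.fun_div hφ1 (hφ0 t)
  have hQ := (hf1.fun_mul hf2).fun_mul (hφ1.fun_pow 2)
  have hR := hf2.fun_div hf1 (hf0 t)
  have hG := isCoordMetricOn_coordWarped (a := a) hD hD0 hφ hφ0 hf hf0 hK
  have hΓ : ∀ u v w, u.2 ∈ S → christoffel (coordWarped D a φ f K) u v w
      = warpedChristoffel D a K N (fun t => deriv φ t / φ t)
        (fun t => f t * deriv f t * φ t ^ 2) (fun t => deriv f t / f t) u v w :=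
    fun u v w hu => christoffel_coordWarped hD hD0 hφ hφ0 hf hf0 hK hN hu v w
  rw [coordRicci, LinearMap.trace_prod_eq_add,
    trace_fst_block_of_warped hD hK hG hN hΓ hu hP.differentiableAt hQ.differentiableAt
      hR.differentiableAt,
    trace_snd_block_of_warped hK hG hΓ hu hP.differentiableAt hQ.differentiableAt
      hR.differentiableAt, ← ht, hP.deriv, hQ.deriv, hR.deriv]
  have h1 := hφ0 t
  have h2 := hf0 t
  field_simp
  ring

/-- Since dh = h' a sees only the base, the fibre part of Γ drops out and the Hessian is h'' a⊗a −
h' a(Γ). -/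
theorem coordHess_coordWarped (hD : ∀ v w, D v w = D w v)
    (hD0 : ∀ v, (∀ w, D v w = 0) → v = 0) (hφ : ContDiff ℝ ∞ φ) (hφ0 : ∀ t, φ t ≠ 0)
    (hf : ContDiff ℝ ∞ f) (hf0 : ∀ t, f t ≠ 0) (hh : ContDiff ℝ ∞ h) (hK : IsCoordMetricOn K S)
    (hN : ∀ z, D N z = a z) {u : V × W} (hu : u.2 ∈ S) {t : ℝ} (ht : a u.1 = t) (w z : V × W) :
    coordHess (coordWarped D a φ f K) (fun x => h (a x.1)) u w z
      = (deriv (deriv h) t + 2 * (deriv φ t / φ t) * deriv h t) * (a w.1 * a z.1)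
        - deriv φ t / φ t * deriv h t * a N * D w.1 z.1
        + f t * deriv f t * φ t ^ 2 * deriv h t * a N * K u.2 w.2 z.2 := by
  subst ht
  have h1 : fderiv ℝ (fun x : V × W => h (a x.1))
      = fun x => deriv h (a x.1) • a.comp (.fst ℝ V W) :=
    funext fun x => (hasFDerivAt_comp_fst a (hh.differentiable (by simp) _)).fderiv
  have h2 := ((hasFDerivAt_comp_fst a (u := u) ((contDiff_infty_iff_deriv.1 hh).2.differentiable
    (by simp) _)).smul_const (a.comp (.fst ℝ V W))).fderiv
  rw [coordHess, h1, h2, christoffel_coordWarped hD hD0 hφ hφ0 hf hf0 hK hN hu]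
  simp
  ring

/-- Clearing the nonvanishing denominators turns the three coefficients into the three differential
equations. The Einstein condition on K is needed only at the point considered. -/
theorem coord_quasiEinstein_defect (hD : ∀ v w, D v w = D w v)
    (hD0 : ∀ v, (∀ w, D v w = 0) → v = 0) (hφ : ContDiff ℝ ∞ φ) (hφ0 : ∀ t, φ t ≠ 0)
    (hf : ContDiff ℝ ∞ f) (hf0 : ∀ t, f t ≠ 0) (hh : ContDiff ℝ ∞ h) (hh0 : ∀ t, h t ≠ 0)
    (hK : IsCoordMetricOn K S) (hN : ∀ z, D N z = a z) {u : V × W} (hu : u.2 ∈ S) {lam : ℝ}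
    (hlam : ∀ w z, coordRicci K u.2 w z = lam * K u.2 w z) {t : ℝ} (ht : a u.1 = t) (r ρ : ℝ)
    (w z : V × W) :
    coordRicci (coordWarped D a φ f K) u w z
        - r / h t * coordHess (coordWarped D a φ f K) (fun x => h (a x.1)) u w z
        - ρ * coordWarped D a φ f K u w z
      = ((Module.finrank ℝ V - 2) * f t * h t * deriv (deriv φ) t
            - r * f t * φ t * deriv (deriv h) t - Module.finrank ℝ W * h t * φ t * deriv (deriv f) t
            - 2 * Module.finrank ℝ W * h t * deriv φ t * deriv f t
            - 2 * r * f t * deriv φ t * deriv h t) / (f t * h t * φ t) * (a w.1 * a z.1)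
        + (a N * (f t * h t * φ t * deriv (deriv φ) t
              - (Module.finrank ℝ V - 1) * f t * h t * deriv φ t ^ 2
              + Module.finrank ℝ W * h t * φ t * deriv φ t * deriv f t
              + r * f t * φ t * deriv φ t * deriv h t) - ρ * f t * h t) / (f t * h t * φ t ^ 2)
            * D w.1 z.1
        + (a N * (-(f t * h t * φ t ^ 2 * deriv (deriv f) t)
              + (Module.finrank ℝ V - 2) * f t * h t * φ t * deriv φ t * deriv f t
              - (Module.finrank ℝ W - 1) * h t * φ t ^ 2 * deriv f t ^ 2
              - r * f t * φ t ^ 2 * deriv f t * deriv h t) - h t * (ρ * f t ^ 2 - lam)) / h t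
            * K u.2 w.2 z.2 := by
  rw [coordRicci_coordWarped hD hD0 hφ hφ0 hf hf0 hK hN hu ht,
    coordHess_coordWarped hD hD0 hφ hφ0 hf hf0 hh hK hN hu ht, coordWarped_apply, hlam, ht]
  have h1 := hφ0 t
  have h2 := hf0 t
  have h3 := hh0 t
  field_simp
  ring

end WarpedQuasiEinstein

/-! ### From manifolds to coordinates -/

section Charts

variable {E : Type*} [NormedAddCommGroup E] [NormedSpace ℝ E]
  {H : Type*} [TopologicalSpace H] {I : ModelWithCorners ℝ E H}
  {M : Type*} [TopologicalSpace M] [ChartedSpace H M]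

/-- The tangent space at p is identified with E by the chart at p itself, so in that chart the map
reads as the identity near the base point. -/
theorem mfderiv_extChartAt_symm_self [IsManifold I ∞ M] [I.Boundaryless] (p : M) :
    (mfderiv 𝓘(ℝ, E) I (extChartAt I p).symm (extChartAt I p p) : E →L[ℝ] E)
      = ContinuousLinearMap.id ℝ E := by
  have h1 : MDifferentiableAt 𝓘(ℝ, E) I (extChartAt I p).symm (extChartAt I p p) :=
    ((contMDiffOn_extChartAt_symm (n := ∞) p).contMDiffAt
      (extChartAt_target_mem_nhds p)).mdifferentiableAt (by simp)
  rw [h1.mfderiv]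
  simp only [writtenInExtChartAt, extChartAt_to_inv, ModelWithCorners.range_eq_univ,
    fderivWithin_univ, extChartAt_model_space_eq_id]
  have h2 : ((extChartAt I p) ∘ (extChartAt I p).symm ∘ (PartialEquiv.refl E).symm)
      =ᶠ[𝓝 (extChartAt I p p)] id := by
    filter_upwards [extChartAt_target_mem_nhds p] with u hu
    exact (extChartAt I p).right_inv hu
  have h3 : fderiv ℝ ((extChartAt I p) ∘ (extChartAt I p).symm ∘ (PartialEquiv.refl E).symm)
      (extChartAt I p p) = ContinuousLinearMap.id ℝ E := by
    rw [h2.fderiv_eq, fderiv_id]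
  exact h3

theorem chartMetric_self [IsManifold I ∞ M] [I.Boundaryless]
    (g : (q : M) → TangentSpace I q →L[ℝ] TangentSpace I q →L[ℝ] ℝ) (p : M) :
    chartMetric g p (extChartAt I p p) = (g p : E →L[ℝ] E →L[ℝ] ℝ) := by
  let B : M → E →L[ℝ] E →L[ℝ] ℝ := g
  let A : E →L[ℝ] E := mfderiv 𝓘(ℝ, E) I (extChartAt I p).symm (extChartAt I p p)
  have hA : A = ContinuousLinearMap.id ℝ E := mfderiv_extChartAt_symm_self p
  change (B ((extChartAt I p).symm (extChartAt I p p))).bilinearComp A A = B p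
  rw [hA, extChartAt_to_inv]
  rfl

theorem chartMetric_modelSpace (g : E → E →L[ℝ] E →L[ℝ] ℝ) (p u : E) :
    chartMetric (I := 𝓘(ℝ, E)) (M := E) g p u = g u := by
  let A : E →L[ℝ] E := mfderiv 𝓘(ℝ, E) 𝓘(ℝ, E) (extChartAt 𝓘(ℝ, E) p).symm u
  have hA : A = ContinuousLinearMap.id ℝ E := by
    unfold A
    rw [extChartAt_model_space_eq_id]
    exact mfderiv_id (I := 𝓘(ℝ, E)) (x := u)
  change (g ((extChartAt 𝓘(ℝ, E) p).symm u)).bilinearComp A A = g u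
  rw [hA, extChartAt_model_space_eq_id]
  rfl

theorem SemiRiemannianMetric.isCoordMetricOn_chartMetric [IsManifold I ∞ M] [I.Boundaryless]
    (g : SemiRiemannianMetric I M) (p : M) :
    IsCoordMetricOn (chartMetric g.form p) (extChartAt I p).target := by
  refine ⟨isOpen_extChartAt_target p, g.smooth p, fun u _ v w => g.symm _ _ _, fun u hu v hv => ?_⟩
  have : IsManifold I 1 M := .of_le (n := ∞) (by norm_cast)
  let A : E →L[ℝ] E := mfderiv 𝓘(ℝ, E) I (extChartAt I p).symm u
  -- Nondegeneracy survives the pull-back because the derivative of the inverse chart is invertible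
  -- on the whole target.
  have hA : A.IsInvertible := by
    have h1 := isInvertible_mfderivWithin_extChartAt_symm (I := I) hu
    rw [ModelWithCorners.range_eq_univ, mfderivWithin_univ] at h1
    exact h1
  let B : E →L[ℝ] E →L[ℝ] ℝ := g.form ((extChartAt I p).symm u)
  have hB : ∀ x, (∀ y, B x y = 0) → x = 0 := g.nondegenerate ((extChartAt I p).symm u)
  have hv' : ∀ w, B (A v) (A w) = 0 := hv
  have h2 : A v = 0 := hB _ fun y => by
    have h3 := hv' (A.inverse y)
    rwa [hA.self_apply_inverse] at h3
  rw [← hA.inverse_apply_self v, h2, map_zero]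

end Charts

/-! ### The invariant metric on ℝⁿ × F and the three equations -/

section InvariantWarped

/-- The linear form `x ↦ ∑ α_i x_i` on `ℝⁿ`. -/
noncomputable def linearInvariantCLM {n : ℕ} (α : Fin n → ℝ) : EuclideanSpace ℝ (Fin n) →L[ℝ] ℝ :=
  ∑ i, α i • (EuclideanSpace.proj i : EuclideanSpace ℝ (Fin n) →L[ℝ] ℝ)

theorem linearInvariantCLM_apply {n : ℕ} (α : Fin n → ℝ) (x : EuclideanSpace ℝ (Fin n)) :
    linearInvariantCLM α x = linearInvariant α x := by
  simp [linearInvariantCLM, linearInvariant]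

theorem linearInvariant_single {n : ℕ} (α : Fin n → ℝ) (i : Fin n) (c : ℝ) :
    linearInvariant α (EuclideanSpace.single i c) = α i * c := by
  simp [linearInvariant]

theorem diagonalForm_single {n : ℕ} (ε : Fin n → ℝ) (i j : Fin n) (c d : ℝ) :
    diagonalForm ε (EuclideanSpace.single i c) (EuclideanSpace.single j d)
      = if i = j then ε i * (c * d) else 0 := by
  rw [diagonalForm_apply, Finset.sum_eq_single i]
  · by_cases h : i = j <;> simp [h]
  · intro k _ hk
    simp [hk]
  · simp

theorem linearInvariant_surjective {n : ℕ} {α : Fin n → ℝ} (hα : α ≠ 0) :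
    Function.Surjective (linearInvariant α) := by
  obtain ⟨i, hi⟩ := Function.ne_iff.1 hα
  intro t
  refine ⟨EuclideanSpace.single i (t / α i), ?_⟩
  rw [linearInvariant_single]
  exact mul_div_cancel₀ t hi

/-- The symmetric tensors `α ⊗ α` and `∑ ε_i dx_i²` are linearly independent for `n ≥ 2`. -/
theorem eq_zero_of_rank_one_add_diagonal {n : ℕ} (hn : 2 ≤ n) {ε α : Fin n → ℝ}
    (hε : ∀ i, ε i ≠ 0) (hα : α ≠ 0) {A B : ℝ}
    (h : ∀ v w, A * (linearInvariant α v * linearInvariant α w) + B * diagonalForm ε v w = 0) :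
    A = 0 ∧ B = 0 := by
  obtain ⟨i, hi⟩ := Function.ne_iff.1 hα
  have hi' : α i ≠ 0 := hi
  have : Nontrivial (Fin n) := Fin.nontrivial_iff_two_le.2 hn
  obtain ⟨j, hj⟩ := exists_ne i
  have hij := h (EuclideanSpace.single i 1) (EuclideanSpace.single j 1)
  have hii := h (EuclideanSpace.single i 1) (EuclideanSpace.single i 1)
  have hjj := h (EuclideanSpace.single j 1) (EuclideanSpace.single j 1)
  simp only [linearInvariant_single, diagonalForm_single, hj.symm, if_true, if_false, mul_one,
    mul_zero, add_zero] at hij hii hjj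
  -- The off-diagonal (i, j) entry A α_i α_j vanishes with α_i ≠ 0, so A α_j = 0 and the (j, j)
  -- entry leaves B ε_j = 0.
  have hB : B = 0 := by
    have h1 : A * α j = 0 := by
      have : A * α j * α i = 0 := by rw [← hij]; ring
      exact (mul_eq_zero.1 this).resolve_right hi'
    have h2 : B * ε j = 0 := by linear_combination hjj - α j * h1
    exact (mul_eq_zero.1 h2).resolve_right (hε j)
  rw [hB, zero_mul, add_zero] at hii
  exact ⟨(mul_eq_zero.1 hii).resolve_right (mul_ne_zero hi' hi'), hB⟩

variable {n m : ℕ} {ε : Fin n → ℝ} {hε : ∀ i, ε i = 1 ∨ ε i = -1}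
  {F : Type*} [TopologicalSpace F] [ChartedSpace (EuclideanSpace ℝ (Fin m)) F]
  [IsManifold 𝓘(ℝ, EuclideanSpace ℝ (Fin m)) ∞ F]
  {gF : SemiRiemannianMetric 𝓘(ℝ, EuclideanSpace ℝ (Fin m)) F} {lamF : ℝ}
  {α : Fin n → ℝ} {f φ h : ℝ → ℝ}
  {hf : ContDiff ℝ ∞ f} {hφ : ContDiff ℝ ∞ φ}
  {hf0 : ∀ t, 0 < f t} {hφ0 : ∀ t, φ t ≠ 0}

theorem chartMetric_conformal_pseudoEuclideanMetric (p u : EuclideanSpace ℝ (Fin n)) :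
    chartMetric ((pseudoEuclideanMetric ε hε).conformal (fun x => φ (linearInvariant α x))
      (contMDiff_comp_linearInvariant α hφ) (fun _ => hφ0 _)).form p u
      = (1 / φ (linearInvariantCLM α u) ^ 2) • diagonalForm ε := by
  rw [linearInvariantCLM_apply]
  exact chartMetric_modelSpace
    ((pseudoEuclideanMetric ε hε).conformal (fun x => φ (linearInvariant α x))
      (contMDiff_comp_linearInvariant α hφ) (fun _ => hφ0 _)).form p u

theorem chartMetric_invariantWarpedMetric (p : EuclideanSpace ℝ (Fin n) × F) :
    chartMetric (invariantWarpedMetric ε hε α f φ hf hf0 hφ hφ0 gF).form p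
      =ᶠ[𝓝 (p.1, extChartAt 𝓘(ℝ, EuclideanSpace ℝ (Fin m)) p.2 p.2)]
        coordWarped (diagonalForm ε) (linearInvariantCLM α) φ f (chartMetric gF.form p.2) := by
  have h1 := extChartAt_target_mem_nhds
    (I := 𝓘(ℝ, EuclideanSpace ℝ (Fin n)).prod 𝓘(ℝ, EuclideanSpace ℝ (Fin m))) p
  have h0 : extChartAt (𝓘(ℝ, EuclideanSpace ℝ (Fin n)).prod 𝓘(ℝ, EuclideanSpace ℝ (Fin m))) p p
      = (p.1, extChartAt 𝓘(ℝ, EuclideanSpace ℝ (Fin m)) p.2 p.2) := by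
    rw [extChartAt_prod, extChartAt_model_space_eq_id]
    rfl
  rw [h0] at h1
  filter_upwards [h1] with u hu
  refine (chartMetric_warpedForm _ _ gF p u hu).trans ?_
  rw [chartMetric_conformal_pseudoEuclideanMetric (hφ := hφ) (hφ0 := hφ0), extChartAt_model_space_eq_id, coordWarped,
    linearInvariantCLM_apply]
  rfl

theorem invariantWarpedMetric_quasiEinstein_defect (hF : gF.IsEinstein lamF)
    (hh : ContDiff ℝ ∞ h) (hh0 : ∀ t, h t ≠ 0) (r ρ : ℝ) (p : EuclideanSpace ℝ (Fin n) × F)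
    {t : ℝ} (ht : linearInvariant α p.1 = t)
    (v w : EuclideanSpace ℝ (Fin n) × EuclideanSpace ℝ (Fin m)) :
    (invariantWarpedMetric ε hε α f φ hf hf0 hφ hφ0 gF).ricci p v w
        - r / h t * (invariantWarpedMetric ε hε α f φ hf hf0 hφ hφ0 gF).hess
            (fun q => h (linearInvariant α q.1)) p v w
        - ρ * (invariantWarpedMetric ε hε α f φ hf hf0 hφ hφ0 gF).form p v w
      = ((n - 2) * f t * h t * deriv (deriv φ) t
            - r * f t * φ t * deriv (deriv h) t - m * h t * φ t * deriv (deriv f) t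
            - 2 * m * h t * deriv φ t * deriv f t
            - 2 * r * f t * deriv φ t * deriv h t) / (f t * h t * φ t)
          * (linearInvariant α v.1 * linearInvariant α w.1)
        + ((∑ k, ε k * α k ^ 2) * (f t * h t * φ t * deriv (deriv φ) t
              - (n - 1) * f t * h t * deriv φ t ^ 2
              + m * h t * φ t * deriv φ t * deriv f t
              + r * f t * φ t * deriv φ t * deriv h t) - ρ * f t * h t) / (f t * h t * φ t ^ 2)
            * diagonalForm ε v.1 w.1
        + ((∑ k, ε k * α k ^ 2) * (-(f t * h t * φ t ^ 2 * deriv (deriv f) t)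
              + (n - 2) * f t * h t * φ t * deriv φ t * deriv f t
              - (m - 1) * h t * φ t ^ 2 * deriv f t ^ 2
              - r * f t * φ t ^ 2 * deriv f t * deriv h t) - h t * (ρ * f t ^ 2 - lamF)) / h t
            * gF.form p.2 v.2 w.2 := by
  -- This is α with its index raised; ε_i is its own inverse.
  let N : EuclideanSpace ℝ (Fin n) := WithLp.toLp 2 fun i => ε i * α i
  have hεε : ∀ i, ε i * ε i = 1 := fun i => by rcases hε i with h | h <;> simp [h]
  have hN : ∀ z, diagonalForm ε N z = linearInvariantCLM α z := fun z => by
    rw [diagonalForm_apply, linearInvariantCLM_apply, linearInvariant]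
    refine Finset.sum_congr rfl fun i _ => ?_
    change ε i * (ε i * α i * z i) = _
    linear_combination (α i * z i) * hεε i
  have haN : linearInvariantCLM α N = ∑ k, ε k * α k ^ 2 := by
    rw [linearInvariantCLM_apply, linearInvariant]
    refine Finset.sum_congr rfl fun i _ => ?_
    change α i * (ε i * α i) = _
    ring
  let y := extChartAt 𝓘(ℝ, EuclideanSpace ℝ (Fin m)) p.2 p.2
  have hy : chartMetric gF.form p.2 y = gF.form p.2 := chartMetric_self gF.form p.2
  have key := coord_quasiEinstein_defect (u := (p.1, y))
    ((pseudoEuclideanMetric ε hε).symm 0) ((pseudoEuclideanMetric ε hε).nondegenerate 0) hφ hφ0 hf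
    (fun t => (hf0 t).ne') hh hh0 (gF.isCoordMetricOn_chartMetric p.2) hN
    (mem_extChartAt_target p.2) (lam := lamF) (fun w z => by rw [hy]; exact hF p.2 w z)
    ((linearInvariantCLM_apply α p.1).trans ht) r ρ v w
  rw [haN, hy, finrank_euclideanSpace_fin, finrank_euclideanSpace_fin,
    linearInvariantCLM_apply α v.1, linearInvariantCLM_apply α w.1] at key
  refine Eq.trans ?_ key
  have h0 : extChartAt (𝓘(ℝ, EuclideanSpace ℝ (Fin n)).prod 𝓘(ℝ, EuclideanSpace ℝ (Fin m))) p p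
      = (p.1, y) := by
    rw [extChartAt_prod, extChartAt_model_space_eq_id]
    rfl
  have hG := chartMetric_invariantWarpedMetric (gF := gF) (ε := ε) (hε := hε) (α := α)
    (hf := hf) (hf0 := hf0) (hφ := hφ) (hφ0 := hφ0) p
  have h1 : (fun q : EuclideanSpace ℝ (Fin n) × F => h (linearInvariant α q.1)) ∘
      (extChartAt (𝓘(ℝ, EuclideanSpace ℝ (Fin n)).prod 𝓘(ℝ, EuclideanSpace ℝ (Fin m))) p).symm
      = fun x => h (linearInvariantCLM α x.1) := by
    funext x
    rw [extChartAt_prod, extChartAt_model_space_eq_id, linearInvariantCLM_apply]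
    rfl
  refine congrArg₂ (· - ·) (congrArg₂ (· - ·) ?_ (congrArg (r / h t * ·) ?_))
    (congrArg (ρ * ·) ?_)
  · unfold SemiRiemannianMetric.ricci
    rw [h0]
    exact coordRicci_congr hG v w
  · unfold SemiRiemannianMetric.hess
    rw [h0, h1]
    exact coordHess_congr hG .rfl v w
  · rw [coordWarped_apply, hy, linearInvariantCLM_apply]
    rfl

/-- Both causal types are treated at once, since only α ≠ 0 is needed to separate the coefficients.
Pairs of horizontal vectors isolate a⊗a and D; pairs of vertical ones isolate the fibre term. -/
theorem isQuasiEinstein_invariantWarpedMetric_iff [Nonempty F] (hn : 2 ≤ n) (hm : 1 ≤ m)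
    (hF : gF.IsEinstein lamF) (hα : α ≠ 0) (hh : ContDiff ℝ ∞ h) (hh0 : ∀ t, h t ≠ 0) (r ρ : ℝ) :
    (invariantWarpedMetric ε hε α f φ hf hf0 hφ hφ0 gF).IsQuasiEinstein
        (fun p => h (linearInvariant α p.1)) r ρ ↔
      ∀ t : ℝ,
        (n - 2) * f t * h t * deriv (deriv φ) t
            - r * f t * φ t * deriv (deriv h) t - m * h t * φ t * deriv (deriv f) t
            - 2 * m * h t * deriv φ t * deriv f t
            - 2 * r * f t * deriv φ t * deriv h t = 0 ∧
        (∑ k, ε k * α k ^ 2) * (f t * h t * φ t * deriv (deriv φ) t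
              - (n - 1) * f t * h t * deriv φ t ^ 2
              + m * h t * φ t * deriv φ t * deriv f t
              + r * f t * φ t * deriv φ t * deriv h t) = ρ * f t * h t ∧
        (∑ k, ε k * α k ^ 2) * (-(f t * h t * φ t ^ 2 * deriv (deriv f) t)
              + (n - 2) * f t * h t * φ t * deriv φ t * deriv f t
              - (m - 1) * h t * φ t ^ 2 * deriv f t ^ 2
              - r * f t * φ t ^ 2 * deriv f t * deriv h t) = h t * (ρ * f t ^ 2 - lamF) := by
  have hf0' : ∀ t, f t ≠ 0 := fun t => (hf0 t).ne'
  constructor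
  · intro hq t
    obtain ⟨x, hx⟩ := linearInvariant_surjective hα t
    obtain ⟨q⟩ := ‹Nonempty F›
    have key := fun v w => (invariantWarpedMetric_quasiEinstein_defect (ε := ε) (hε := hε)
      (hf := hf) (hf0 := hf0) (hφ := hφ) (hφ0 := hφ0) hF hh hh0 r ρ (x, q) hx v w).symm.trans
        (sub_eq_zero.2 (by have := hq (x, q) v w; simpa only [hx] using this))
    let b : EuclideanSpace ℝ (Fin m) →L[ℝ] EuclideanSpace ℝ (Fin m) →L[ℝ] ℝ := gF.form q
    have hb : ∀ v, (∀ w, b v w = 0) → v = 0 := gF.nondegenerate q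
    obtain ⟨hA, hB⟩ := eq_zero_of_rank_one_add_diagonal (ε := ε) hn
      (fun i => by rcases hε i with h | h <;> simp [h]) hα fun v w => by
        have h1 := key (v, 0) (w, 0)
        have h2 : gF.form q (0 : EuclideanSpace ℝ (Fin m)) (0 : EuclideanSpace ℝ (Fin m)) = 0 :=
          (b 0).map_zero
        rw [h2, mul_zero, add_zero] at h1
        exact h1
    -- A zero form would be degenerate, as m ≥ 1 supplies a nonzero vector.
    have hC : ∃ v w, b v w ≠ 0 := by
      by_contra! h0
      have h1 := hb (EuclideanSpace.single ⟨0, hm⟩ 1) (h0 _)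
      simpa using congrArg (fun v : EuclideanSpace ℝ (Fin m) => v ⟨0, hm⟩) h1
    obtain ⟨v, w, hvw⟩ := hC
    have h3 := key (0, v) (0, w)
    rw [hA, hB, zero_mul, zero_mul, zero_add, zero_add] at h3
    have h4 := (mul_eq_zero.1 h3).resolve_right hvw
    have h5 := mul_ne_zero (hf0' t) (hh0 t)
    exact ⟨(div_eq_zero_iff.1 hA).resolve_right (mul_ne_zero h5 (hφ0 t)),
      sub_eq_zero.1 ((div_eq_zero_iff.1 hB).resolve_right (mul_ne_zero h5 (pow_ne_zero 2 (hφ0 t)))),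
      sub_eq_zero.1 ((div_eq_zero_iff.1 h4).resolve_right (hh0 t))⟩
  · intro hq p v w
    obtain ⟨h1, h2, h3⟩ := hq (linearInvariant α p.1)
    have key := invariantWarpedMetric_quasiEinstein_defect (ε := ε) (hε := hε)
      (α := α) (hf := hf) (hf0 := hf0) (hφ := hφ) (hφ0 := hφ0) hF hh hh0 r ρ p rfl v w
    rw [h1, h2, h3, sub_self, sub_self, zero_div, zero_div, zero_div, zero_mul, zero_mul, zero_mul,
      add_zero, add_zero] at key
    exact sub_eq_zero.1 key

end InvariantWarped

/-! ### The non-null and null cases -/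

theorem mainTheorem4 (n m r : ℕ) (hn : 3 ≤ n) (hm : 1 ≤ m)
    (ε : Fin n → ℝ) (hε : ∀ i, ε i = 1 ∨ ε i = -1)
    {F : Type*} [TopologicalSpace F] [ChartedSpace (EuclideanSpace ℝ (Fin m)) F]
    [IsManifold 𝓘(ℝ, EuclideanSpace ℝ (Fin m)) ∞ F] [Nonempty F]
    (gF : SemiRiemannianMetric 𝓘(ℝ, EuclideanSpace ℝ (Fin m)) F)
    (lamF : ℝ) (hF : gF.IsEinstein lamF)
    (α : Fin n → ℝ) (f φ h : ℝ → ℝ)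
    (hf : ContDiff ℝ ∞ f) (hφ : ContDiff ℝ ∞ φ) (hh : ContDiff ℝ ∞ h)
    (hf0 : ∀ t, 0 < f t) (hφ0 : ∀ t, φ t ≠ 0) (hh0 : ∀ t, h t ≠ 0) (ρ : ℝ) :
    ((∑ k, ε k * α k ^ 2 = 1 ∨ ∑ k, ε k * α k ^ 2 = -1) →
      ((invariantWarpedMetric ε hε α f φ hf hf0 hφ hφ0 gF).IsQuasiEinstein
          (fun p => h (linearInvariant α p.1)) r ρ ↔
        ∀ t : ℝ,
          ((n : ℝ) - 2) * f t * h t * deriv (deriv φ) t - r * f t * φ t * deriv (deriv h) t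
              - m * h t * φ t * deriv (deriv f) t - 2 * m * h t * deriv φ t * deriv f t
              - 2 * r * f t * deriv φ t * deriv h t = 0 ∧
          ∑ k, ε k * α k ^ 2 *
              (f t * h t * φ t * deriv (deriv φ) t - ((n : ℝ) - 1) * f t * h t * deriv φ t ^ 2
                + m * h t * φ t * deriv φ t * deriv f t + r * f t * φ t * deriv φ t * deriv h t)
            = ρ * f t * h t ∧
          ∑ k, ε k * α k ^ 2 *
              (-(f t * h t * φ t ^ 2 * deriv (deriv f) t)
                + ((n : ℝ) - 2) * f t * h t * φ t * deriv φ t * deriv f t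
                - ((m : ℝ) - 1) * h t * φ t ^ 2 * deriv f t ^ 2
                - r * f t * φ t ^ 2 * deriv f t * deriv h t)
            = h t * (ρ * f t ^ 2 - lamF))) ∧
    ((α ≠ 0 ∧ ∑ k, ε k * α k ^ 2 = 0) →
      ((invariantWarpedMetric ε hε α f φ hf hf0 hφ hφ0 gF).IsQuasiEinstein
          (fun p => h (linearInvariant α p.1)) r ρ ↔
        (∀ t : ℝ,
          ((n : ℝ) - 2) * f t * h t * deriv (deriv φ) t - r * f t * φ t * deriv (deriv h) t
              - m * h t * φ t * deriv (deriv f) t - 2 * m * h t * deriv φ t * deriv f t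
              - 2 * r * f t * deriv φ t * deriv h t = 0) ∧
        ρ = 0 ∧ lamF = 0)) := by
  have hsum : ∀ c : ℝ, ∑ k, ε k * α k ^ 2 * c = (∑ k, ε k * α k ^ 2) * c :=
    fun c => (Finset.sum_mul _ _ _).symm
  refine ⟨fun hs => ?_, fun ⟨hα, hs⟩ => ?_⟩
  · have hα : α ≠ 0 := by
      rintro rfl
      simp at hs
    rw [isQuasiEinstein_invariantWarpedMetric_iff (by omega) hm hF hα hh hh0]
    simp only [hsum]
  · rw [isQuasiEinstein_invariantWarpedMetric_iff (by omega) hm hF hα hh hh0]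
    simp only [hs, zero_mul]
    refine ⟨fun hq => ⟨fun t => (hq t).1, ?_⟩, fun ⟨h1, h2, h3⟩ t => ⟨h1 t, ?_, ?_⟩⟩
    -- With the sum zero the equations read ρ f h = 0 and h (ρ f² − λ_F) = 0; the single value ξ = 0
    -- already forces both constants to vanish.
    · have hρ : ρ = 0 := by simpa [(hf0 0).ne', hh0 0] using (hq 0).2.1
      refine ⟨hρ, ?_⟩
      simpa [hρ, hh0 0] using (hq 0).2.2
    · simp [h2]
    · simp [h2, h3]
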